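/- Let $(\Omega,\nu)$ be an atomless standard Borel probability space and let $W:\Omega^2\to[0,1]$ be a graphon, i.e. a symmetric measurable function. A function $c\in L^\infty(\Omega)$ is a *fractional vertex cover* of $W$ if $0\le c\le 1$ almost everywhere and the set $\{(x,y)\in\Omega^2: W(x,y)>0,\ c(x)+c(y)<1\}$ has $\nu^{\otimes 2}$-measure $0$. The set of all fractional vertex covers of $W$ is a convex subset of $L^\infty(\Omega)$, called the *fractional vertex cover polyton* of $W$. The graphon $W$ is *bipartite* if there is a partition $\Omega=\Omega_A\sqcup\Omega_B$ into two measurable sets of positive measure such that $W$ is zero almost everywhere on $(\Omega_A\times\Omega_A)\cup(\Omega_B\times\Omega_B)$. **Theorem.** If every extreme point of the fractional vertex cover polyton of $W$ is integral, i.e. takes values in $\{0,1\}$ almost everywhere, then $W$ is bipartite. -/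

import Mathlib

open MeasureTheory
open scoped ENNReal

/-- A graphon on `(Ω, ν)`: a symmetric `[0,1]`-valued function on `Ω × Ω` that is measurable for
the completion of the product measure `ν ⊗ ν` (in particular every Borel one is allowed). -/
structure Graphon {Ω : Type*} [MeasurableSpace Ω] (ν : Measure Ω) where
  toFun : Ω × Ω → ℝ
  aemeasurable' : AEMeasurable toFun (ν.prod ν)
  symm' : ∀ x y : Ω, toFun (x, y) = toFun (y, x)
  mem_Icc' : ∀ p : Ω × Ω, toFun p ∈ Set.Icc (0 : ℝ) 1

namespace Graphon

/-- The graphon `W` is bipartite if `Ω` can be partitioned into two sets of positive measure such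
that `W` vanishes almost everywhere on the two diagonal blocks. -/
def IsBipartite {Ω : Type*} [MeasurableSpace Ω] {ν : Measure Ω} (W : Graphon ν) : Prop :=
  ∃ A B : Set Ω, MeasurableSet A ∧ MeasurableSet B ∧ Disjoint A B ∧ A ∪ B = Set.univ ∧
    0 < ν A ∧ 0 < ν B ∧
    ∀ᵐ p ∂(ν.prod ν), p ∈ (A ×ˢ A) ∪ (B ×ˢ B) → W.toFun p = 0

/-- `c ∈ L^∞(Ω)` is a fractional vertex cover of `W` if `0 ≤ c ≤ 1` almost everywhere and the set
`supp W \ {(x, y) : c x + c y ≥ 1}` is null. -/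
def IsFractionalVertexCover {Ω : Type*} [MeasurableSpace Ω] {ν : Measure Ω} (W : Graphon ν)
    (c : Lp ℝ ∞ ν) : Prop :=
  (∀ᵐ x ∂ν, 0 ≤ c x ∧ c x ≤ 1) ∧
    (ν.prod ν) (Function.support W.toFun \ {p : Ω × Ω | c p.1 + c p.2 ≥ 1}) = 0

/-- The fractional vertex cover polyton of `W`, a subset of the vector space `L^∞(Ω)`. -/
def fracCoverPolyton {Ω : Type*} [MeasurableSpace Ω] {ν : Measure Ω} (W : Graphon ν) :
    Set (Lp ℝ ∞ ν) :=
  {c | W.IsFractionalVertexCover c}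

end Graphon

/-- An element of `L^∞(Ω)` is integral if its values are in `{0, 1}` almost everywhere. -/
def IsIntegralFunction {Ω : Type*} [MeasurableSpace Ω] {ν : Measure Ω} (c : Lp ℝ ∞ ν) : Prop :=
  ∀ᵐ x ∂ν, c x = 0 ∨ c x = 1

/-! The tight covers, for which `c x + c y = 1` almost everywhere on the support of `W`, form a face
of the polyton, nonempty because it contains the constant `1/2`. In `L²` this face is convex, closed
and bounded, so weak compactness and Krein–Milman give it an extreme point, which is then extreme in
the polyton (`exists_mem_extremePoints_fracCoverPolyton_isTightCover`). By hypothesis this tight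
cover is integral, so the support of `W` joins `{c = 1}` to its complement. -/

theorem Convex.extremePoints_nonempty_of_isClosed_of_isBounded {H : Type*} [NormedAddCommGroup H]
    [InnerProductSpace ℝ H] [CompleteSpace H] {K : Set H} (hconv : Convex ℝ K) (hc : IsClosed K)
    (hb : Bornology.IsBounded K) (hne : K.Nonempty) : (K.extremePoints ℝ).Nonempty := by
  -- By Riesz, `K` can be viewed in the weak-* dual: Hahn–Banach makes its image closed and
  -- Banach–Alaoglu makes it compact.
  let e : H ≃ₗ[ℝ] WeakDual ℝ H :=
    (InnerProductSpace.toDual ℝ H).toLinearEquiv.trans StrongDual.toWeakDual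
  have he (x y : H) : e x y = inner ℝ x y := rfl
  have hcl : IsClosed (e '' K) := by
    have hsub : closure (e '' K) ⊆ e '' K := by
      intro φ hφ
      obtain ⟨x, rfl⟩ := e.surjective φ
      by_contra hx
      have hxK : x ∉ K := fun h ↦ hx ⟨x, h, rfl⟩
      obtain ⟨f, u, hu, hux⟩ := geometric_hahn_banach_closed_point hconv hc hxK
      obtain ⟨y, rfl⟩ := (InnerProductSpace.toDual ℝ H).surjective f
      simp only [InnerProductSpace.toDual_apply_apply] at hu hux
      have hset : IsClosed {φ : WeakDual ℝ H | φ y ≤ u} :=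
        isClosed_le (WeakDual.eval_continuous y) continuous_const
      have : e x ∈ {φ : WeakDual ℝ H | φ y ≤ u} := by
        refine closure_minimal ?_ hset hφ
        rintro _ ⟨z, hz, rfl⟩
        simp only [Set.mem_ofPred_eq, he]
        rw [real_inner_comm]
        exact (hu z hz).le
      simp only [Set.mem_ofPred_eq, he] at this
      rw [real_inner_comm] at this
      exact this.not_gt hux
    exact isClosed_of_closure_subset hsub
  have hcomp : IsCompact (e '' K) := by
    obtain ⟨r, hr⟩ := hb.subset_closedBall 0
    refine (WeakDual.isCompact_closedBall 0 r).of_isClosed_subset hcl ?_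
    rintro _ ⟨x, hx, rfl⟩
    have := hr hx
    rw [mem_closedBall_zero_iff] at this
    simp only [Set.mem_preimage, mem_closedBall_zero_iff]
    exact (LinearIsometryEquiv.norm_map (InnerProductSpace.toDual ℝ H) x).le.trans this
  have : LocallyConvexSpace ℝ (WeakDual ℝ H) :=
    inferInstanceAs (LocallyConvexSpace ℝ (WeakBilin (topDualPairing ℝ H)))
  obtain ⟨φ, hφ⟩ := hcomp.extremePoints_nonempty (hne.image e)
  rw [← image_extremePoints e] at hφ
  obtain ⟨x, hx, -⟩ := hφ
  exact ⟨x, hx⟩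

/-- If every measurable set were null or conull, countable separation would concentrate `ν` on at
most one point, which is null. -/
theorem MeasureTheory.exists_measurableSet_pos_compl_pos {Ω : Type*} [MeasurableSpace Ω]
    [StandardBorelSpace Ω] (ν : Measure Ω) [IsProbabilityMeasure ν] [NullSingletonClass ν] :
    ∃ A : Set Ω, MeasurableSet A ∧ 0 < ν A ∧ 0 < ν Aᶜ := by
  by_contra! h
  obtain ⟨s, hs, hsν⟩ := Filter.exists_subsingleton_mem_of_forall_separating
    (l := ae ν) MeasurableSet fun U hU ↦ by
      rcases eq_or_ne (ν U) 0 with h0 | h0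
      · exact Or.inr (compl_mem_ae_iff.2 h0)
      · exact Or.inl (mem_ae_iff.2 (le_antisymm (h U hU (pos_iff_ne_zero.2 h0)) zero_le))
  have h0 : ν s = 0 := hs.measure_zero ν
  have h1 : ν sᶜ = 0 := hsν
  have : ν (s ∪ sᶜ) = 0 := measure_union_null h0 h1
  simp at this
namespace Graphon

variable {Ω : Type*} [MeasurableSpace Ω] {ν : Measure Ω}

/-- A function `c` is a tight cover of `W` if `0 ≤ c ≤ 1` almost everywhere and
`c x + c y = 1` for almost every `(x, y)` in the support of `W`. -/
def IsTightCover (W : Graphon ν) (c : Ω → ℝ) : Prop :=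
  (∀ᵐ x ∂ν, 0 ≤ c x ∧ c x ≤ 1) ∧
    ∀ᵐ p ∂(ν.prod ν), W.toFun p ≠ 0 → c p.1 + c p.2 = 1

theorem isFractionalVertexCover_iff_ae (W : Graphon ν) (c : Lp ℝ ∞ ν) :
    W.IsFractionalVertexCover c ↔ (∀ᵐ x ∂ν, 0 ≤ c x ∧ c x ≤ 1) ∧
      ∀ᵐ p ∂(ν.prod ν), W.toFun p ≠ 0 → 1 ≤ c p.1 + c p.2 := by
  refine and_congr Iff.rfl ?_
  rw [ae_iff]
  have : Function.support W.toFun \ {p : Ω × Ω | c p.1 + c p.2 ≥ 1} =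
      {p | ¬(W.toFun p ≠ 0 → 1 ≤ c p.1 + c p.2)} := by
    ext p
    simp
  rw [this]

theorem ae_prod_of_ae {P : Ω → Prop} (h : ∀ᵐ x ∂ν, P x) :
    ∀ᵐ p ∂(ν.prod ν), P p.1 ∧ P p.2 :=
  (Measure.quasiMeasurePreserving_fst.ae h).and (Measure.quasiMeasurePreserving_snd.ae h)

theorem IsTightCover.congr {W : Graphon ν} {c d : Ω → ℝ} (h : W.IsTightCover c)
    (hcd : c =ᵐ[ν] d) : W.IsTightCover d := by
  refine ⟨?_, ?_⟩
  · filter_upwards [h.1, hcd] with x hx hxd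
    rwa [← hxd]
  · filter_upwards [h.2, ae_prod_of_ae hcd] with p hp hpd
    rwa [← hpd.1, ← hpd.2]

theorem IsTightCover.convexCombination {W : Graphon ν} {c d : Ω → ℝ} (hc : W.IsTightCover c)
    (hd : W.IsTightCover d) {a b : ℝ} (ha : 0 ≤ a) (hb : 0 ≤ b) (hab : a + b = 1) :
    W.IsTightCover (a • c + b • d) := by
  refine ⟨?_, ?_⟩
  · filter_upwards [hc.1, hd.1] with x hx hy
    exact convex_Icc (0 : ℝ) 1 hx hy ha hb hab
  · filter_upwards [hc.2, hd.2] with p hp hq hW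
    have h1 := hp hW
    have h2 := hq hW
    simp only [Pi.add_apply, Pi.smul_apply, smul_eq_mul]
    linear_combination a * h1 + b * h2 + hab

theorem IsTightCover.of_tendsto {W : Graphon ν} {c : ℕ → Ω → ℝ} {d : Ω → ℝ}
    (hc : ∀ n, W.IsTightCover (c n))
    (h : ∀ᵐ x ∂ν, Filter.Tendsto (fun n ↦ c n x) Filter.atTop (nhds (d x))) :
    W.IsTightCover d := by
  refine ⟨?_, ?_⟩
  · filter_upwards [ae_all_iff.2 fun n ↦ (hc n).1, h] with x hx hxd
    exact isClosed_Icc.mem_of_tendsto hxd (Filter.Eventually.of_forall hx)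
  · filter_upwards [ae_all_iff.2 fun n ↦ (hc n).2, ae_prod_of_ae h] with p hp hpd hW
    refine tendsto_nhds_unique (hpd.1.add hpd.2) ?_
    simp only [fun n ↦ hp n hW, tendsto_const_nhds]

theorem isTightCover_half (W : Graphon ν) : W.IsTightCover fun _ ↦ 1 / 2 :=
  ⟨Filter.Eventually.of_forall fun _ ↦ by norm_num,
    Filter.Eventually.of_forall fun _ _ ↦ by norm_num⟩

theorem IsTightCover.memLp [IsFiniteMeasure ν] {W : Graphon ν} {c : Ω → ℝ}
    (hc : W.IsTightCover c) (hm : AEStronglyMeasurable c ν) (p : ℝ≥0∞) : MemLp c p ν := by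
  refine MemLp.of_bound hm 1 ?_
  filter_upwards [hc.1] with x hx
  rw [Real.norm_eq_abs, abs_of_nonneg hx.1]
  exact hx.2

theorem exists_extremePoint_isTightCover [IsProbabilityMeasure ν] (W : Graphon ν) :
    ({c : Lp ℝ 2 ν | W.IsTightCover c}.extremePoints ℝ).Nonempty := by
  refine Convex.extremePoints_nonempty_of_isClosed_of_isBounded ?_ ?_ ?_ ?_
  · intro c hc d hd a b ha hb hab
    refine (IsTightCover.convexCombination hc hd ha hb hab).congr ?_
    filter_upwards [Lp.coeFn_add (a • c) (b • d), Lp.coeFn_smul a c, Lp.coeFn_smul b d]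
      with x h1 h2 h3
    rw [h1, Pi.add_apply, Pi.add_apply, h2, h3]
  · refine IsSeqClosed.isClosed fun c d hc hcd ↦ ?_
    -- Tightness passes to almost everywhere limits, and `L²` convergence provides one along a
    -- subsequence.
    obtain ⟨φ, -, hφ⟩ := (tendstoInMeasure_of_tendsto_Lp hcd).exists_seq_tendsto_ae
    exact IsTightCover.of_tendsto (fun n ↦ hc (φ n)) hφ
  · refine (Metric.isBounded_closedBall (x := (0 : Lp ℝ 2 ν)) (r := 1)).subset fun c hc ↦ ?_
    rw [mem_closedBall_zero_iff]
    refine (Lp.norm_le_of_ae_bound zero_le_one ?_).trans_eq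
      (by simp [measureUnivNNReal] : _ = (1 : ℝ))
    filter_upwards [hc.1] with x hx
    rw [Real.norm_eq_abs, abs_of_nonneg hx.1]
    exact hx.2
  · exact ⟨(memLp_const (1 / 2 : ℝ)).toLp, W.isTightCover_half.congr (MemLp.coeFn_toLp _).symm⟩

theorem exists_mem_extremePoints_fracCoverPolyton_isTightCover [IsProbabilityMeasure ν]
    (W : Graphon ν) : ∃ c ∈ Set.extremePoints ℝ W.fracCoverPolyton, W.IsTightCover c := by
  obtain ⟨c, hc⟩ := W.exists_extremePoint_isTightCover
  rw [mem_extremePoints_iff_left] at hc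
  obtain ⟨hcT, hcE⟩ := hc
  have hcm : MemLp c ∞ ν := IsTightCover.memLp hcT (Lp.aestronglyMeasurable c) ∞
  have hcc : hcm.toLp =ᵐ[ν] c := hcm.coeFn_toLp
  have hcT' : W.IsTightCover hcm.toLp := IsTightCover.congr hcT hcc.symm
  refine ⟨hcm.toLp, mem_extremePoints_iff_left.2 ⟨?_, ?_⟩, hcT'⟩
  · refine (W.isFractionalVertexCover_iff_ae _).2 ⟨hcT'.1, ?_⟩
    filter_upwards [hcT'.2] with p hp hW
    exact (hp hW).ge
  · rintro u hu v hv ⟨a, b, ha, hb, hab, huv⟩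
    obtain ⟨hu0, hu1⟩ := (W.isFractionalVertexCover_iff_ae _).1 hu
    obtain ⟨hv0, hv1⟩ := (W.isFractionalVertexCover_iff_ae _).1 hv
    have huvc : ∀ᵐ x ∂ν, a * u x + b * v x = c x := by
      rw [← huv] at hcc
      filter_upwards [hcc, Lp.coeFn_add (a • u) (b • v), Lp.coeFn_smul a u, Lp.coeFn_smul b v]
        with x h1 h2 h3 h4
      rw [← h1, h2, Pi.add_apply, h3, h4, Pi.smul_apply, Pi.smul_apply, smul_eq_mul, smul_eq_mul]
    -- The face property: both sums are at least `1` and their average with positive weights is `1`,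
    -- so both equal `1`.
    have key : ∀ᵐ p ∂(ν.prod ν), W.toFun p ≠ 0 → u p.1 + u p.2 = 1 ∧ v p.1 + v p.2 = 1 := by
      filter_upwards [hu1, hv1, hcT.2, ae_prod_of_ae huvc] with p h1 h2 h3 h4 hW
      have h1 := h1 hW
      have h2 := h2 hW
      have h3 := h3 hW
      rw [← h4.1, ← h4.2] at h3
      constructor <;> nlinarith
    have huT : W.IsTightCover u := ⟨hu0, key.mono fun p hp hW ↦ (hp hW).1⟩
    have hvT : W.IsTightCover v := ⟨hv0, key.mono fun p hp hW ↦ (hp hW).2⟩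
    -- Extremality of `c` is known in `L²`, so `u` and `v` are moved there.
    have hum := huT.memLp (Lp.aestronglyMeasurable u) 2
    have hvm := hvT.memLp (Lp.aestronglyMeasurable v) 2
    have huc : hum.toLp = c := by
      refine hcE _ (huT.congr hum.coeFn_toLp.symm) (hvm.toLp)
        (hvT.congr hvm.coeFn_toLp.symm) ⟨a, b, ha, hb, hab, ?_⟩
      refine Lp.ext ?_
      filter_upwards [huvc, Lp.coeFn_add (a • hum.toLp) (b • hvm.toLp),
        Lp.coeFn_smul a hum.toLp, Lp.coeFn_smul b hvm.toLp, hum.coeFn_toLp, hvm.coeFn_toLp]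
        with x h1 h2 h3 h4 h5 h6
      rw [h2, Pi.add_apply, h3, h4, Pi.smul_apply, Pi.smul_apply, h5, h6, smul_eq_mul,
        smul_eq_mul, h1]
    refine Lp.ext ?_
    have h := hum.coeFn_toLp
    rw [huc] at h
    exact h.symm.trans hcc.symm

theorem isBipartite_of_ae_eq_zero [StandardBorelSpace Ω] [IsProbabilityMeasure ν]
    [NullSingletonClass ν] {W : Graphon ν} (h : ∀ᵐ p ∂(ν.prod ν), W.toFun p = 0) :
    W.IsBipartite := by
  obtain ⟨A, hA, h1, h2⟩ := exists_measurableSet_pos_compl_pos ν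
  exact ⟨A, Aᶜ, hA, hA.compl, disjoint_compl_right, Set.union_compl_self A, h1, h2,
    h.mono fun _ hp _ ↦ hp⟩

end Graphon

theorem mainTheorem2 {Ω : Type*} [MeasurableSpace Ω] [StandardBorelSpace Ω]
    (ν : Measure Ω) [IsProbabilityMeasure ν] [NullSingletonClass ν] (W : Graphon ν)
    (hW : ∀ c ∈ Set.extremePoints ℝ W.fracCoverPolyton, IsIntegralFunction c) :
    W.IsBipartite := by
  obtain ⟨c, hc, hcT⟩ := W.exists_mem_extremePoints_fracCoverPolyton_isTightCover
  have hint := hW c hc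
  have hcm : Measurable c := (Lp.stronglyMeasurable c).measurable
  set A : Set Ω := c ⁻¹' {1} with hAdef
  have hA : MeasurableSet A := hcm (measurableSet_singleton 1)
  have hdiag : ∀ᵐ p ∂(ν.prod ν), p ∈ (A ×ˢ A) ∪ (Aᶜ ×ˢ Aᶜ) → W.toFun p = 0 := by
    filter_upwards [hcT.2, Graphon.ae_prod_of_ae hint] with p hp hpi hpA
    by_contra hne
    have h1 := hp hne
    rcases hpA with ⟨ha, hb⟩ | ⟨ha, hb⟩
    · rw [show c p.1 = 1 from ha, show c p.2 = 1 from hb] at h1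
      norm_num at h1
    · rw [hpi.1.resolve_right ha, hpi.2.resolve_right hb] at h1
      norm_num at h1
  -- If one side is null, `W` vanishes almost everywhere and any partition into two sets of positive
  -- measure works.
  by_cases hA0 : ν A = 0
  · refine Graphon.isBipartite_of_ae_eq_zero ?_
    filter_upwards [hdiag, Graphon.ae_prod_of_ae (compl_mem_ae_iff.2 hA0)] with p hp hpA
    exact hp (Or.inr hpA)
  by_cases hA1 : ν Aᶜ = 0
  · refine Graphon.isBipartite_of_ae_eq_zero ?_
    filter_upwards [hdiag, Graphon.ae_prod_of_ae (mem_ae_iff.2 hA1)] with p hp hpA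
    exact hp (Or.inl hpA)
  exact ⟨A, Aᶜ, hA, hA.compl, disjoint_compl_right, Set.union_compl_self A,
    pos_iff_ne_zero.2 hA0, pos_iff_ne_zero.2 hA1, hdiag⟩
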